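/- All graphs are finite and simple, and a path contains an edge if the edge is one of its edges. Let $G$ be a graph. A set $\mathscr{P}$ of paths of $G$ is strongly separating if for every ordered pair $(e,f)$ of distinct edges of $G$ some path in $\mathscr{P}$ contains $e$ and avoids $f$; let $c_\infty(G)$ be the smallest size of a strongly separating set of paths of $G$. For an integer $k\ge 2$, a multiset $\mathscr{P}$ of paths of $G$ is a $k$-rainbow separating path system if its elements can be colored with $k$ colors (not all of which need be used) so that for every pair of distinct edges $e_1,e_2$ of $G$ there are paths $P_1,P_2\in\mathscr{P}$ of distinct colors such that $P_1$ contains $e_1$ but not $e_2$ and $P_2$ contains $e_2$ but not $e_1$; let $c_k(G)$ be the smallest cardinality of a $k$-rainbow separating path system of $G$. The chromatic separation number of $G$ is $$\chi_{rs}(G):=\min\{k\in\{2,3,\dots\} : c_k(G)=c_\infty(G)\}.$$ **Corollary.** For every integer $k\ge 3$ there are infinitely many pairwise non-isomorphic trees $T$ with $\chi_{rs}(T)=k$. -/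

import Mathlib

namespace RainbowSep

variable {V : Type*}

/-- The (simple, undirected) paths of `G`, as subgraphs of `G`. -/
def GraphPath (G : SimpleGraph V) : Type _ :=
  {H : G.Subgraph // ∃ (u v : V) (p : G.Walk u v), p.IsPath ∧ p.toSubgraph = H}

/-- The edge set of a path. -/
def GraphPath.edges {G : SimpleGraph V} (P : GraphPath G) : Set (Sym2 V) :=
  P.1.edgeSet

/-- A set of paths is strongly separating if for every ordered pair of distinct edges `(e, f)`
some path of the set contains `e` and avoids `f`. -/
def IsStronglySeparating (G : SimpleGraph V) (S : Set (GraphPath G)) : Prop :=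
  ∀ e ∈ G.edgeSet, ∀ f ∈ G.edgeSet, e ≠ f → ∃ P ∈ S, e ∈ P.edges ∧ f ∉ P.edges

/-- The strong separation number `ssp(G) = c_∞(G)`: the least size of a strongly separating
path system. -/
noncomputable def strongSepNumber (G : SimpleGraph V) : ℕ∞ :=
  ⨅ (S : Set (GraphPath G)) (_ : IsStronglySeparating G S), S.encard

/-- A multiset `M` of paths is a `k`-rainbow separating path system if its elements can be coloured
with `k` colours (`Q` is `M` with a colour attached to each element) such that any two distinct
edges `e`, `f` are separated by two paths of distinct colours. -/
def IsRainbowSeparating (G : SimpleGraph V) (k : ℕ) (M : Multiset (GraphPath G)) : Prop :=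
  ∃ Q : Multiset (GraphPath G × Fin k), Q.map Prod.fst = M ∧
    ∀ e ∈ G.edgeSet, ∀ f ∈ G.edgeSet, e ≠ f →
      ∃ x ∈ Q, ∃ y ∈ Q, x.2 ≠ y.2 ∧
        (e ∈ x.1.edges ∧ f ∉ x.1.edges) ∧ (f ∈ y.1.edges ∧ e ∉ y.1.edges)

/-- The `k`-rainbow separation number `c_k(G)`: the least cardinality of a `k`-rainbow separating
path system of `G`. -/
noncomputable def rainbowSepNumber (G : SimpleGraph V) (k : ℕ) : ℕ∞ :=
  ⨅ (M : Multiset (GraphPath G)) (_ : IsRainbowSeparating G k M), (Multiset.card M : ℕ∞)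

/-- The chromatic separation number `χ_rs(G)`: the least `k ≥ 2` such that `c_k(G) = c_∞(G)`
(and `⊤` if there is no such `k`). -/
noncomputable def chromaticSepNumber (G : SimpleGraph V) : ℕ∞ :=
  ⨅ (k : ℕ) (_ : 2 ≤ k ∧ rainbowSepNumber G k = strongSepNumber G), (k : ℕ∞)

end RainbowSep

namespace RainbowSep

variable {V : Type*} {G : SimpleGraph V}

/-! The trees `binTree L i` are subcubic. Double counting path ends against the `L + i` vertices of
degree at most two shows that a separating family has at least `L + i` paths (`card_low_le`). A
family of exactly that size is rigid: no path ends in a cubic vertex (`not_isEnd`) and every leaf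
edge is in exactly two paths (`inExactlyTwo_leaf`), a property that climbs through cubic vertices to
every edge of the binary part (`inExactlyTwo_cubic`).

Rigidity bounds the number of colours from below. If a path contains `r` edges that are each in only
one other path, those other paths have pairwise distinct colours (`RainbowSeparates.le_colors`). A
path that enters the binary part must descend to a leaf, so deep trees need many colours
(`HasRainbow.binTree_le`).

Growing the tree by one branching costs one path and at most one colour (`HasRainbow.binTree_succ`),
and three colours suffice at `i = 1` when `L` is 1 modulo 3 (`hasRainbow_binTree_one`). Hence, as
`i` grows, the number of colours needed passes through every `k ≥ 3`; varying `L` gives infinitely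
many trees for each `k`. -/

/-! ### Paths: ends, neighbours, images and prolongations. -/

/-- A vertex is an end of a path if exactly one edge of the path is incident with it. -/
def IsEnd (P : GraphPath G) (v : V) : Prop :=
  ∃ x, s(v, x) ∈ P.edges ∧ ∀ y, s(v, y) ∈ P.edges → y = x

theorem GraphPath.edges_subset (P : GraphPath G) {e : Sym2 V} (h : e ∈ P.edges) : e ∈ G.edgeSet :=
  P.1.edgeSet_subset h

theorem GraphPath.neighbors_cases (P : GraphPath G) :
    ∃ a b : V, ∀ v, (∃ x, s(v, x) ∈ P.edges) →
      ((v = a ∨ v = b) ∧ ∃ x, ∀ y, s(v, y) ∈ P.edges → y = x) ∨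
      ∃ x z, x ≠ z ∧ ∀ y, s(v, y) ∈ P.edges ↔ y = x ∨ y = z := by
  obtain ⟨H, a, b, p, hp, rfl⟩ := P
  refine ⟨a, b, fun v ⟨x, hx⟩ => ?_⟩
  have key : ∀ y, s(v, y) ∈ GraphPath.edges ⟨p.toSubgraph, a, b, p, hp, rfl⟩ ↔
      y ∈ p.toSubgraph.neighborSet v := fun y => Iff.rfl
  simp only [key] at hx ⊢
  have hv : v ∈ p.support := by
    rw [← SimpleGraph.Walk.mem_verts_toSubgraph]
    exact p.toSubgraph.edge_vert hx
  have hnil : ¬ p.Nil := by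
    intro hn
    cases hn
    simp at hx
  obtain ⟨i, hi, hle⟩ := SimpleGraph.Walk.mem_support_iff_exists_getVert.1 hv
  by_cases h0 : i = 0
  · subst h0
    rw [SimpleGraph.Walk.getVert_zero] at hi
    subst hi
    left
    exact ⟨Or.inl rfl, p.snd, fun y hy => by
      rwa [hp.neighborSet_toSubgraph_startpoint hnil] at hy⟩
  by_cases h1 : i = p.length
  · subst h1
    rw [SimpleGraph.Walk.getVert_length] at hi
    subst hi
    left
    exact ⟨Or.inr rfl, p.penultimate, fun y hy => by
      rwa [hp.neighborSet_toSubgraph_endpoint hnil] at hy⟩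
  · right
    have hn := hp.neighborSet_toSubgraph_internal h0 (by omega)
    have hc := hp.ncard_neighborSet_toSubgraph_internal_eq_two h0 (by omega)
    rw [hi] at hn hc
    refine ⟨p.getVert (i - 1), p.getVert (i + 1), ?_, fun y => ?_⟩
    · intro h
      rw [hn, h] at hc
      simp at hc
    · rw [hn]; rfl

theorem GraphPath.exists_ends (P : GraphPath G) : ∃ a b : V, ∀ v, IsEnd P v → v = a ∨ v = b := by
  obtain ⟨a, b, h⟩ := P.neighbors_cases
  refine ⟨a, b, fun v ⟨x, hx, hu⟩ => ?_⟩
  rcases h v ⟨x, hx⟩ with h | ⟨y, z, hyz, h⟩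
  · exact h.1
  · exact absurd ((hu y ((h y).2 (Or.inl rfl))).trans (hu z ((h z).2 (Or.inr rfl))).symm) hyz

/-- The path carried by a walk without repeated vertices. -/
def GraphPath.ofWalk {u v : V} (p : G.Walk u v) (hp : p.IsPath) : GraphPath G :=
  ⟨p.toSubgraph, u, v, p, hp, rfl⟩

theorem GraphPath.mem_edges_ofWalk {u v : V} (p : G.Walk u v) (hp : p.IsPath) (e : Sym2 V) :
    e ∈ (GraphPath.ofWalk p hp).edges ↔ e ∈ p.edges :=
  p.mem_edges_toSubgraph

theorem GraphPath.exists_length_two {a b c : V} (hab : G.Adj a b) (hbc : G.Adj b c) (hac : a ≠ c) :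
    ∃ P : GraphPath G, ∀ e, e ∈ P.edges ↔ e = s(a, b) ∨ e = s(b, c) := by
  refine ⟨GraphPath.ofWalk (.cons hab (.cons hbc .nil)) ?_, fun e => ?_⟩
  · simp [SimpleGraph.Walk.isPath_def, hab.ne, hbc.ne, hac]
  · rw [GraphPath.mem_edges_ofWalk]
    simp

theorem GraphPath.exists_length_three {a b c d : V} (hab : G.Adj a b) (hbc : G.Adj b c)
    (hcd : G.Adj c d) (hac : a ≠ c) (had : a ≠ d) (hbd : b ≠ d) :
    ∃ P : GraphPath G, ∀ e, e ∈ P.edges ↔ e = s(a, b) ∨ e = s(b, c) ∨ e = s(c, d) := by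
  refine ⟨GraphPath.ofWalk (.cons hab (.cons hbc (.cons hcd .nil))) ?_, fun e => ?_⟩
  · simp [SimpleGraph.Walk.isPath_def, hab.ne, hbc.ne, hcd.ne, hac, had, hbd]
  · rw [GraphPath.mem_edges_ofWalk]
    simp

theorem GraphPath.exists_map {V' : Type*} {G' : SimpleGraph V'} (f : G →g G')
    (hf : Function.Injective f) (P : GraphPath G) :
    ∃ P' : GraphPath G', ∀ e, e ∈ P'.edges ↔ ∃ e' ∈ P.edges, e'.map f = e := by
  obtain ⟨H, a, b, p, hp, rfl⟩ := P
  refine ⟨GraphPath.ofWalk (p.map f) (hp.map hf), fun e => ?_⟩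
  rw [GraphPath.mem_edges_ofWalk, SimpleGraph.Walk.edges_map, List.mem_map]
  exact exists_congr fun e' => and_congr_left fun _ => (p.mem_edges_toSubgraph).symm

/-- A path ending in a leaf `l` can be prolonged by an edge from `l` to a new vertex `a`. -/
theorem GraphPath.exists_extend {V' : Type*} {G' : SimpleGraph V'} (f : G →g G')
    (hf : Function.Injective f) (P : GraphPath G) {l w : V} (hl : ∀ t, G.Adj l t ↔ t = w)
    (hP : s(l, w) ∈ P.edges) {a : V'} (ha : a ∉ Set.range f) (hal : G'.Adj a (f l)) :
    ∃ P' : GraphPath G', ∀ e, e ∈ P'.edges ↔ (∃ e' ∈ P.edges, e'.map f = e) ∨ e = s(a, f l) := by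
  obtain ⟨H, u, v, p, hp, rfl⟩ := P
  have main : ∀ (v : V) (q : G.Walk l v), q.IsPath →
      ∃ P' : GraphPath G', ∀ e, e ∈ P'.edges ↔
        (∃ e' ∈ q.edges, e'.map f = e) ∨ e = s(a, f l) := by
    intro v q hq
    refine ⟨GraphPath.ofWalk (.cons hal (q.map f)) ?_, fun e => ?_⟩
    · rw [SimpleGraph.Walk.cons_isPath_iff]
      refine ⟨hq.map hf, fun h => ha ?_⟩
      rw [SimpleGraph.Walk.support_map, List.mem_map] at h
      obtain ⟨x, -, hx⟩ := h
      exact ⟨x, hx⟩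
    · rw [GraphPath.mem_edges_ofWalk, SimpleGraph.Walk.edges_cons, List.mem_cons,
        SimpleGraph.Walk.edges_map, List.mem_map, or_comm]
  have hmem : ∀ e, e ∈ GraphPath.edges ⟨p.toSubgraph, u, v, p, hp, rfl⟩ ↔ e ∈ p.edges :=
    fun e => p.mem_edges_toSubgraph
  -- An inner vertex of a path has two neighbours on it, and a leaf has only one.
  have hend : l = u ∨ l = v := by
    by_contra hne
    push Not at hne
    have hv : l ∈ p.support := p.fst_mem_support_of_mem_edges ((hmem _).1 hP)
    obtain ⟨i, hi, hle⟩ := SimpleGraph.Walk.mem_support_iff_exists_getVert.1 hv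
    have h0 : i ≠ 0 := by
      rintro rfl
      exact hne.1 (by rw [← hi, SimpleGraph.Walk.getVert_zero])
    have h1 : i ≠ p.length := by
      rintro rfl
      exact hne.2 (by rw [← hi, SimpleGraph.Walk.getVert_length])
    have hc := hp.ncard_neighborSet_toSubgraph_internal_eq_two h0 (by omega)
    rw [hi] at hc
    have hsub : p.toSubgraph.neighborSet l ⊆ {w} := fun y hy => (hl y).1 (p.toSubgraph.adj_sub hy)
    have := Set.ncard_le_ncard hsub (Set.finite_singleton w)
    rw [Set.ncard_singleton] at this
    omega
  simp only [hmem]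
  rcases hend with rfl | rfl
  · exact main v p hp
  · obtain ⟨P', hP'⟩ := main u p.reverse hp.reverse
    exact ⟨P', fun e => by rw [hP']; simp⟩

/-! ### Indexed separating families and the chromatic separation number. -/

/-- A family of paths that separates any two distinct edges in both directions. -/
def Separates {ι : Type*} (G : SimpleGraph V) (p : ι → GraphPath G) : Prop :=
  ∀ e ∈ G.edgeSet, ∀ f ∈ G.edgeSet, e ≠ f → ∃ i, e ∈ (p i).edges ∧ f ∉ (p i).edges

/-- A coloured family of paths that separates any two distinct edges by paths of distinct
colours. -/
def RainbowSeparates {ι κ : Type*} (G : SimpleGraph V) (p : ι → GraphPath G) (c : ι → κ) : Prop :=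
  ∀ e ∈ G.edgeSet, ∀ f ∈ G.edgeSet, e ≠ f → ∃ i j, c i ≠ c j ∧
    (e ∈ (p i).edges ∧ f ∉ (p i).edges) ∧ (f ∈ (p j).edges ∧ e ∉ (p j).edges)

theorem RainbowSeparates.separates {ι κ : Type*} {p : ι → GraphPath G} {c : ι → κ}
    (h : RainbowSeparates G p c) : Separates G p := fun e he f hf hef => by
  obtain ⟨i, -, -, hi, -⟩ := h e he f hf hef
  exact ⟨i, hi⟩

/-- There is a rainbow separating family of `n` paths with `k` colours. -/
def HasRainbow (G : SimpleGraph V) (n k : ℕ) : Prop :=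
  ∃ (p : Fin n → GraphPath G) (c : Fin n → Fin k), RainbowSeparates G p c

theorem HasRainbow.of_fintype {ι : Type*} [Fintype ι] {n k : ℕ} (hn : Fintype.card ι = n)
    {p : ι → GraphPath G} {c : ι → Fin k} (h : RainbowSeparates G p c) : HasRainbow G n k := by
  let e := Fintype.equivFinOfCardEq hn
  refine ⟨p ∘ e.symm, c ∘ e.symm, fun x hx y hy hxy => ?_⟩
  obtain ⟨i, j, h⟩ := h x hx y hy hxy
  exact ⟨e i, e j, by simpa using h⟩

theorem isRainbowSeparating_of_family {n k : ℕ} {p : Fin n → GraphPath G} {c : Fin n → Fin k}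
    (h : RainbowSeparates G p c) :
    IsRainbowSeparating G k (Multiset.map p Finset.univ.val) := by
  refine ⟨Multiset.map (fun i => (p i, c i)) Finset.univ.val, by
    rw [Multiset.map_map]; rfl, fun e he f hf hef => ?_⟩
  obtain ⟨i, j, hij, h1, h2⟩ := h e he f hf hef
  exact ⟨(p i, c i), Multiset.mem_map.2 ⟨i, Finset.mem_univ i, rfl⟩, (p j, c j),
    Multiset.mem_map.2 ⟨j, Finset.mem_univ j, rfl⟩, hij, h1, h2⟩

theorem HasRainbow.of_isRainbowSeparating {k : ℕ} {M : Multiset (GraphPath G)}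
    (h : IsRainbowSeparating G k M) : HasRainbow G (Multiset.card M) k := by
  obtain ⟨Q, rfl, hQ⟩ := h
  rw [Multiset.card_map]
  induction Q using Quotient.inductionOn with
  | _ l =>
    refine ⟨fun i => (l.get i).1, fun i => (l.get i).2, fun e he f hf hef => ?_⟩
    obtain ⟨x, hx, y, hy, h⟩ := hQ e he f hf hef
    obtain ⟨i, rfl⟩ := List.get_of_mem (Multiset.mem_coe.1 hx)
    obtain ⟨j, rfl⟩ := List.get_of_mem (Multiset.mem_coe.1 hy)
    exact ⟨i, j, h⟩

/-- If every separating family has at least `N` paths, the chromatic separation number is the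
least number of colours of a rainbow separating family of `N` paths. -/
theorem chromaticSepNumber_eq {N k : ℕ}
    (hlow : ∀ (n : ℕ) (p : Fin n → GraphPath G), Separates G p → N ≤ n)
    (hk : 2 ≤ k) (hA : HasRainbow G N k) (hmin : ∀ j, 2 ≤ j → HasRainbow G N j → k ≤ j) :
    chromaticSepNumber G = k := by
  have hsle : (N : ℕ∞) ≤ strongSepNumber G := by
    refine le_iInf₂ fun S hS => ?_
    by_cases hfin : S.Finite
    · have := hfin.fintype
      have hsep : Separates G (fun i => ((Fintype.equivFin S).symm i : GraphPath G)) :=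
        fun e he f hf hef => by
          obtain ⟨P, hP, h⟩ := hS e he f hf hef
          exact ⟨Fintype.equivFin S ⟨P, hP⟩, by simpa using h⟩
      have := hlow _ _ hsep
      rw [Set.encard_eq_coe_toFinset_card, Set.toFinset_card]
      exact_mod_cast this
    · rw [Set.not_finite.1 hfin |>.encard_eq]
      exact le_top
  have hseq : strongSepNumber G = N := by
    refine le_antisymm ?_ hsle
    obtain ⟨p, c, h⟩ := hA
    refine (iInf₂_le (Set.range p) fun e he f hf hef => ?_).trans ?_
    · obtain ⟨i, hi⟩ := h.separates e he f hf hef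
      exact ⟨p i, ⟨i, rfl⟩, hi⟩
    · rw [← Set.image_univ]
      refine (Set.encard_image_le _ _).trans ?_
      simp
  have hrle : ∀ j, (N : ℕ∞) ≤ rainbowSepNumber G j := by
    refine fun j => le_iInf₂ fun M hM => ?_
    obtain ⟨p, c, h⟩ := HasRainbow.of_isRainbowSeparating hM
    exact_mod_cast hlow _ _ h.separates
  apply le_antisymm
  · refine iInf₂_le k ⟨hk, ?_⟩
    rw [hseq]
    refine le_antisymm ?_ (hrle k)
    obtain ⟨p, c, h⟩ := hA
    refine (iInf₂_le _ (isRainbowSeparating_of_family h)).trans ?_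
    simp
  · refine le_iInf₂ fun j ⟨hj, hj'⟩ => ?_
    rw [hseq] at hj'
    -- The strict bound yields an actual system below the infimum's successor; having at least `N`
    -- and fewer than `N + 1` elements, it has exactly `N`.
    have : rainbowSepNumber G j < (N + 1 : ℕ) := by
      rw [hj']; exact_mod_cast Nat.lt_succ_self N
    simp only [rainbowSepNumber, iInf_lt_iff] at this
    obtain ⟨M, hM, hlt⟩ := this
    have h1 : Multiset.card M < N + 1 := by exact_mod_cast hlt
    have h2 : N ≤ Multiset.card M := by
      have := hrle j
      rw [rainbowSepNumber] at this
      exact_mod_cast this.trans (iInf₂_le M hM)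
    have h3 : Multiset.card M = N := by omega
    have := hmin j hj (h3 ▸ HasRainbow.of_isRainbowSeparating hM)
    exact_mod_cast this

/-! ### Subcubic graphs: double counting and the rigidity of optimal families. -/

/-- `v` is a leaf with neighbour `w`. -/
def IsLeafAt (G : SimpleGraph V) (v w : V) : Prop :=
  ∀ t, G.Adj v t ↔ t = w

/-- `w` is a vertex with exactly the three neighbours `x`, `y`, `z`. -/
def IsCubicAt (G : SimpleGraph V) (w x y z : V) : Prop :=
  x ≠ y ∧ x ≠ z ∧ y ≠ z ∧ ∀ t, G.Adj w t ↔ t = x ∨ t = y ∨ t = z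

/-- A graph of maximum degree at most three, whose vertices of degree one and two form the set
`low`, in which every leaf is attached to a cubic vertex and every cubic vertex has a neighbour
that is not a leaf. -/
structure IsSubcubic (G : SimpleGraph V) (low : Finset V) : Prop where
  cubic : ∀ v ∉ low, ∃ x y z, IsCubicAt G v x y z
  leaf_or_two : ∀ v ∈ low, (∃ w ∉ low, IsLeafAt G v w) ∨
    ∃ x y, x ≠ y ∧ ∀ t, G.Adj v t ↔ t = x ∨ t = y
  nonleaf : ∀ v ∉ low, ∃ x, G.Adj v x ∧ ∃ y, G.Adj x y ∧ y ≠ v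

/-- The path consists of the single edge at the leaf `v`. -/
def IsLeafEdge (P : GraphPath G) (v : V) : Prop :=
  ∃ w, IsLeafAt G v w ∧ P.edges = {s(v, w)}

/-- Exactly two members of the family contain the edge. -/
def InExactlyTwo {ι : Type*} (p : ι → GraphPath G) (e : Sym2 V) : Prop :=
  ∃ i j, i ≠ j ∧ ∀ k, e ∈ (p k).edges ↔ k = i ∨ k = j

theorem IsCubicAt.rotate {w x y z : V} (h : IsCubicAt G w x y z) : IsCubicAt G w y z x :=
  ⟨h.2.2.1, h.1.symm, h.2.1.symm, fun t => by rw [h.2.2.2]; tauto⟩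

theorem IsCubicAt.swap {w x y z : V} (h : IsCubicAt G w x y z) : IsCubicAt G w x z y :=
  ⟨h.2.1, h.1, h.2.2.1.symm, fun t => by rw [h.2.2.2]; tauto⟩

theorem IsLeafAt.isEnd {v w : V} (h : IsLeafAt G v w) {P : GraphPath G} (hP : s(v, w) ∈ P.edges) :
    IsEnd P v :=
  ⟨w, hP, fun y hy => (h y).1 (P.edges_subset hy)⟩

theorem IsCubicAt.other {w x y z : V} (h : IsCubicAt G w x y z) {P : GraphPath G}
    (hx : s(w, x) ∈ P.edges) (hend : ¬ IsEnd P w) (hy : s(w, y) ∉ P.edges) :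
    s(w, z) ∈ P.edges := by
  by_contra hz
  refine hend ⟨x, hx, fun t ht => ?_⟩
  rcases (h.2.2.2 t).1 (P.edges_subset ht) with rfl | rfl | rfl
  · rfl
  · exact absurd ht hy
  · exact absurd ht hz

theorem IsCubicAt.edge_ne {w x y z : V} (h : IsCubicAt G w x y z) : s(w, x) ≠ s(w, y) := by
  intro he
  exact h.1 (Sym2.congr_right.1 he)

theorem IsCubicAt.mem_edgeSet {w x y z : V} (h : IsCubicAt G w x y z) : s(w, x) ∈ G.edgeSet :=
  (h.2.2.2 x).2 (Or.inl rfl)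

theorem IsCubicAt.not_isLeafAt {w x y z : V} (h : IsCubicAt G w x y z) (t : V) :
    ¬ IsLeafAt G w t := fun hl =>
  h.1 (((hl x).1 ((h.2.2.2 x).2 (by simp))).trans ((hl y).1 ((h.2.2.2 y).2 (by simp))).symm)

namespace IsSubcubic

variable {low : Finset V}

theorem leaf_mem (h : IsSubcubic G low) {v w : V} (hl : IsLeafAt G v w) : v ∈ low ∧ w ∉ low := by
  have hv : v ∈ low := by
    by_contra hv
    obtain ⟨x, y, z, hc⟩ := h.cubic v hv
    exact hc.not_isLeafAt w hl
  refine ⟨hv, ?_⟩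
  rcases h.leaf_or_two v hv with ⟨w', hw', hl'⟩ | ⟨x, y, hxy, ha⟩
  · have := (hl w').1 ((hl' w').2 rfl)
    exact this ▸ hw'
  · exact absurd (((hl x).1 ((ha x).2 (by simp))).trans ((hl y).1 ((ha y).2 (by simp))).symm) hxy

theorem cubic_of_leaf (h : IsSubcubic G low) {v w : V} (hl : IsLeafAt G v w) :
    ∃ x y, IsCubicAt G w v x y := by
  obtain ⟨x, y, z, hc⟩ := h.cubic w (h.leaf_mem hl).2
  rcases (hc.2.2.2 v).1 ((hl w).2 rfl).symm with rfl | rfl | rfl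
  · exact ⟨y, z, hc⟩
  · exact ⟨z, x, hc.rotate⟩
  · exact ⟨x, y, hc.rotate.rotate⟩

open Classical in
/-- The contribution of a path to a vertex: one for an end, one more for a single leaf edge. -/
noncomputable def charge (P : GraphPath G) (v : V) : ℕ :=
  (if IsEnd P v then 1 else 0) + (if IsLeafEdge P v then 1 else 0)

/-- A path has at most two ends. A single leaf edge gets the extra unit, but its other end is cubic,
hence outside `low`, so its total is still at most 2. -/
theorem sum_charge_path (h : IsSubcubic G low) (P : GraphPath G) :
    ∑ v ∈ low, charge P v ≤ 2 := by
  classical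
  by_cases hP : ∃ v, IsLeafEdge P v
  · obtain ⟨v, w, hl, he⟩ := hP
    have hw := (h.leaf_mem hl).2
    have aux : ∀ u ∈ low, u ≠ v → charge P u = 0 := by
      intro u hu huv
      have hmem : ∀ x, s(u, x) ∉ P.edges := by
        intro x hx
        rw [he, Set.mem_singleton_iff, Sym2.eq_iff] at hx
        rcases hx with ⟨rfl, -⟩ | ⟨rfl, -⟩
        · exact huv rfl
        · exact hw hu
      have h1 : ¬ IsEnd P u := fun ⟨x, hx, _⟩ => hmem x hx
      have h2 : ¬ IsLeafEdge P u := fun ⟨x, _, hx⟩ => hmem x (by rw [hx]; rfl)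
      simp [charge, h1, h2]
    rw [Finset.sum_eq_single v aux (fun hv => absurd (h.leaf_mem hl).1 hv)]
    unfold charge
    split_ifs <;> omega
  · push Not at hP
    obtain ⟨a, b, hab⟩ := P.exists_ends
    simp only [charge, hP, if_false, add_zero]
    rw [← Finset.card_filter]
    refine (Finset.card_le_card (t := {a, b}) fun v hv => ?_).trans Finset.card_le_two
    simpa using hab v (Finset.mem_filter.1 hv).2

/-- Without the extra unit, total charge 2 requires both ends in `low`, leaving no end for `w`. -/
theorem isLeafEdge_of_sum_charge (h : IsSubcubic G low) {P : GraphPath G}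
    (hP : 2 ≤ ∑ v ∈ low, charge P v) {w : V} (hw : w ∉ low) (hend : IsEnd P w) :
    ∃ v, IsLeafAt G v w ∧ P.edges = {s(v, w)} := by
  classical
  by_cases hE : ∃ v, IsLeafEdge P v
  · obtain ⟨v, w', hl, he⟩ := hE
    obtain ⟨x, hx, -⟩ := hend
    have hx' := hx
    rw [he, Set.mem_singleton_iff, Sym2.eq_iff] at hx'
    rcases hx' with ⟨rfl, -⟩ | ⟨rfl, -⟩
    · exact absurd (h.leaf_mem hl).1 hw
    · exact ⟨v, hl, he⟩
  · push Not at hE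
    exfalso
    obtain ⟨a, b, hab⟩ := P.exists_ends
    simp only [charge, hE, if_false, add_zero] at hP
    rw [← Finset.card_filter] at hP
    have hsub : low.filter (fun v => IsEnd P v) ⊆ ({a, b} : Finset V).erase w := fun v hv => by
      rw [Finset.mem_filter] at hv
      rw [Finset.mem_erase]
      exact ⟨fun hvw => hw (hvw ▸ hv.1), by simpa using hab v hv.2⟩
    have h1 := Finset.card_le_card hsub
    have h2 : w ∈ ({a, b} : Finset V) := by simpa using hab w hend
    rw [Finset.card_erase_of_mem h2] at h1
    have := Finset.card_le_two (a := a) (b := b)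
    omega

theorem two_le_sum_of_ne {ι : Type*} [Fintype ι] {f : ι → ℕ} {i j : ι} (hij : i ≠ j)
    (hi : 1 ≤ f i) (hj : 1 ≤ f j) : 2 ≤ ∑ k, f k := by
  classical
  have := Finset.sum_le_sum_of_subset (f := f) (Finset.subset_univ {i, j})
  rw [Finset.sum_pair hij] at this
  omega

theorem one_le_charge {P : GraphPath G} {v : V} (h : IsEnd P v) : 1 ≤ charge P v := by
  simp [charge, h]

variable {ι : Type*} [Fintype ι] {p : ι → GraphPath G}

/-- At a vertex of degree two, the two paths separating its edges both end there. At a leaf, take a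
path through the leaf edge: if it has another edge, separating the leaf edge from that one needs a
second path ending at the leaf; otherwise the extra unit makes up for it. -/
theorem sum_charge_vertex (h : IsSubcubic G low) (hp : Separates G p) {v : V} (hv : v ∈ low) :
    2 ≤ ∑ i, charge (p i) v := by
  rcases h.leaf_or_two v hv with ⟨w, hw, hl⟩ | ⟨x, y, hxy, ha⟩
  · obtain ⟨x, y, hc⟩ := h.cubic_of_leaf hl
    obtain ⟨i, hi, -⟩ := hp _ hc.mem_edgeSet _ hc.rotate.mem_edgeSet hc.edge_ne
    rw [Sym2.eq_swap] at hi
    by_cases hone : IsLeafEdge (p i) v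
    · have : 2 ≤ charge (p i) v := by
        simp [charge, hone, hl.isEnd hi]
      exact this.trans (Finset.single_le_sum (f := fun i => charge (p i) v)
        (fun _ _ => Nat.zero_le _) (Finset.mem_univ i))
    · have : ∃ g ∈ (p i).edges, g ≠ s(v, w) := by
        by_contra hg
        push Not at hg
        exact hone ⟨w, hl, Set.eq_singleton_iff_unique_mem.2 ⟨hi, hg⟩⟩
      obtain ⟨g, hg, hne⟩ := this
      obtain ⟨j, hj, hj'⟩ := hp _ ((p i).edges_subset hi) _ ((p i).edges_subset hg) hne.symm
      exact two_le_sum_of_ne (i := i) (j := j) (by rintro rfl; exact hj' hg)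
        (one_le_charge (hl.isEnd hi)) (one_le_charge (hl.isEnd hj))
  · have hx : s(v, x) ∈ G.edgeSet := (ha x).2 (Or.inl rfl)
    have hy : s(v, y) ∈ G.edgeSet := (ha y).2 (Or.inr rfl)
    have hne : s(v, x) ≠ s(v, y) := fun he => hxy (Sym2.congr_right.1 he)
    obtain ⟨i, hi, hi'⟩ := hp _ hx _ hy hne
    obtain ⟨j, hj, hj'⟩ := hp _ hy _ hx hne.symm
    refine two_le_sum_of_ne (i := i) (j := j) (by rintro rfl; exact hj' hi)
      (one_le_charge ⟨x, hi, fun t ht => ?_⟩) (one_le_charge ⟨y, hj, fun t ht => ?_⟩)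
    · rcases (ha t).1 ((p i).edges_subset ht) with rfl | rfl
      · rfl
      · exact absurd ht hi'
    · rcases (ha t).1 ((p j).edges_subset ht) with rfl | rfl
      · exact absurd ht hj'
      · rfl

/-- A separating family has at least as many paths as there are vertices of degree at most two. -/
theorem card_low_le (h : IsSubcubic G low) (hp : Separates G p) : low.card ≤ Fintype.card ι := by
  have h1 : ∑ v ∈ low, 2 ≤ ∑ v ∈ low, ∑ i, charge (p i) v :=
    Finset.sum_le_sum fun v hv => h.sum_charge_vertex hp hv
  rw [Finset.sum_comm] at h1
  have h2 := h1.trans (Finset.sum_le_sum fun i _ => h.sum_charge_path (p i))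
  simp only [Finset.sum_const, Finset.card_univ, smul_eq_mul] at h2
  omega

/-- With as many paths as low vertices, the double count is an equality, hence an equality term by
term. -/
theorem sum_charge_eq (h : IsSubcubic G low) (hp : Separates G p) (hN : Fintype.card ι = low.card) :
    (∀ v ∈ low, ∑ i, charge (p i) v = 2) ∧ ∀ i, ∑ v ∈ low, charge (p i) v = 2 := by
  have h1 : ∀ v ∈ low, 2 ≤ ∑ i, charge (p i) v := fun v hv => h.sum_charge_vertex hp hv
  have h2 : ∀ i ∈ Finset.univ, ∑ v ∈ low, charge (p i) v ≤ 2 :=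
    fun i _ => h.sum_charge_path (p i)
  have h3 := Finset.sum_le_sum h1
  have h4 := Finset.sum_le_sum h2
  have h5 := Finset.sum_comm (s := low) (t := Finset.univ) (f := fun v i => charge (p i) v)
  have h6 : ∑ v ∈ low, 2 = ∑ i : ι, 2 := by simp [hN]
  constructor
  · intro v hv
    exact ((Finset.sum_eq_sum_iff_of_le h1).1 (by omega) v hv).symm
  · intro i
    exact (Finset.sum_eq_sum_iff_of_le h2).1 (by omega) i (Finset.mem_univ i)

/-- A path that is a single leaf edge exhausts the charge of its leaf. This makes every neighbour of
the cubic vertex `w` a leaf, against `nonleaf`. -/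
theorem not_isLeafEdge (h : IsSubcubic G low) (hp : Separates G p)
    (hN : Fintype.card ι = low.card) (i : ι) (v : V) : ¬ IsLeafEdge (p i) v := by
  classical
  rintro ⟨w, hl, he⟩
  obtain ⟨hv, hw⟩ := h.leaf_mem hl
  obtain ⟨heq1, heq2⟩ := h.sum_charge_eq hp hN
  have hi : s(v, w) ∈ (p i).edges := by rw [he]; rfl
  have honly : ∀ j, s(v, w) ∈ (p j).edges → j = i := by
    intro j hj
    by_contra hne
    have h2 : 2 ≤ charge (p i) v := by
      have : IsLeafEdge (p i) v := ⟨w, hl, he⟩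
      simp [charge, this, hl.isEnd hi]
    have h1 := one_le_charge (hl.isEnd hj)
    have h3 := Finset.sum_le_sum_of_subset (f := fun k => charge (p k) v)
      (Finset.subset_univ {i, j})
    rw [Finset.sum_pair (Ne.symm hne), heq1 v hv] at h3
    omega
  -- A path that contains `wx` and avoids `wy` cannot use `wv` either, by `honly`. So it ends at
  -- `w`, and by tightness it is a single leaf edge.
  have key : ∀ x y, IsCubicAt G w v x y → IsLeafAt G x w := by
    intro x y hc
    obtain ⟨j, hj, hj'⟩ := hp _ hc.rotate.mem_edgeSet _ hc.rotate.rotate.mem_edgeSet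
      hc.rotate.edge_ne
    have hend : IsEnd (p j) w := by
      refine ⟨x, hj, fun t ht => ?_⟩
      rcases (hc.2.2.2 t).1 ((p j).edges_subset ht) with rfl | rfl | rfl
      · exfalso
        rw [Sym2.eq_swap] at ht
        have := honly j ht
        subst this
        rw [he, Set.mem_singleton_iff, Sym2.eq_swap, Sym2.congr_left] at hj
        exact hc.1 hj.symm
      · rfl
      · exact absurd ht hj'
    obtain ⟨u, hu, hue⟩ := h.isLeafEdge_of_sum_charge (heq2 j).ge hw hend
    rw [hue, Set.mem_singleton_iff, Sym2.eq_swap, Sym2.congr_left] at hj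
    exact hj ▸ hu
  obtain ⟨x, y, hc⟩ := h.cubic_of_leaf hl
  obtain ⟨t, ht, s, hs, hsw⟩ := h.nonleaf w hw
  have hlt : IsLeafAt G t w := by
    rcases (hc.2.2.2 t).1 ht with rfl | rfl | rfl
    · exact hl
    · exact key _ _ hc
    · exact key _ _ hc.swap
  exact hsw ((hlt s).1 hs)

/-- In an optimal separating family no path ends in a cubic vertex. -/
theorem not_isEnd (h : IsSubcubic G low) (hp : Separates G p) (hN : Fintype.card ι = low.card)
    (i : ι) {w : V} (hw : w ∉ low) : ¬ IsEnd (p i) w := fun hend => by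
  obtain ⟨v, hl, he⟩ := h.isLeafEdge_of_sum_charge ((h.sum_charge_eq hp hN).2 i).ge hw hend
  exact h.not_isLeafEdge hp hN i v ⟨w, hl, he⟩

/-- In an optimal separating family every leaf edge is in exactly two paths. -/
theorem inExactlyTwo_leaf (h : IsSubcubic G low) (hp : Separates G p)
    (hN : Fintype.card ι = low.card) {v w : V} (hl : IsLeafAt G v w) :
    InExactlyTwo p s(v, w) := by
  classical
  have hv := (h.leaf_mem hl).1
  obtain ⟨x, y, hc⟩ := h.cubic_of_leaf hl
  obtain ⟨i, hi, hi'⟩ := hp _ hc.mem_edgeSet _ hc.rotate.mem_edgeSet hc.edge_ne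
  obtain ⟨j, hj, hj'⟩ := hp _ hc.swap.mem_edgeSet _ hc.swap.rotate.mem_edgeSet hc.swap.edge_ne
  have hw := (h.leaf_mem hl).2
  -- Path `i` does not end at `w` and misses one of the two other edges there, so it uses the other
  -- one, which `j` avoids.
  have hij : i ≠ j := by
    rintro rfl
    exact hj' (hc.other hi (h.not_isEnd hp hN i hw) hi')
  rw [Sym2.eq_swap] at hi hj
  refine ⟨i, j, hij, fun k => ⟨fun hk => ?_, ?_⟩⟩
  -- A third path through the leaf edge would raise the charge of `v` to 3.
  · by_contra hne
    push Not at hne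
    have h1 := one_le_charge (hl.isEnd hi)
    have h2 := one_le_charge (hl.isEnd hj)
    have h3 := one_le_charge (hl.isEnd hk)
    have h4 := Finset.sum_le_sum_of_subset (f := fun k => charge (p k) v)
      (Finset.subset_univ {k, i, j})
    rw [Finset.sum_insert (by simpa using hne), Finset.sum_pair hij,
      (h.sum_charge_eq hp hN).1 v hv] at h4
    omega
  · rintro (rfl | rfl) <;> assumption

/-- The two paths through a leaf edge have distinct colours. -/
theorem color_ne (h : IsSubcubic G low) {κ : Type*} {c : ι → κ} (hp : RainbowSeparates G p c)
    (hN : Fintype.card ι = low.card) {v w : V} (hl : IsLeafAt G v w) {i j : ι}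
    (hij : ∀ k, s(v, w) ∈ (p k).edges ↔ k = i ∨ k = j) : c i ≠ c j := by
  obtain ⟨x, y, hc⟩ := h.cubic_of_leaf hl
  have hw := (h.leaf_mem hl).2
  obtain ⟨a, b, hab, ⟨ha, ha'⟩, hb, hb'⟩ := hp _ hc.rotate.mem_edgeSet _
    hc.rotate.rotate.mem_edgeSet hc.rotate.edge_ne
  -- Both separating paths go on from `w` along the leaf edge, so they are `i` and `j` in some
  -- order.
  have h1 := hc.rotate.other ha (h.not_isEnd hp.separates hN a hw) ha'
  have h2 := hc.rotate.rotate.swap.other hb (h.not_isEnd hp.separates hN b hw) hb'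
  rw [Sym2.eq_swap, hij] at h1 h2
  rcases h1 with rfl | rfl <;> rcases h2 with rfl | rfl
  · exact absurd rfl hab
  · exact hab
  · exact hab.symm
  · exact absurd rfl hab

/-- If two edges at a cubic vertex are in exactly two paths each, so is the third. -/
theorem inExactlyTwo_cubic (h : IsSubcubic G low) (hp : Separates G p)
    (hN : Fintype.card ι = low.card) {w a b d : V} (hw : w ∉ low) (hc : IsCubicAt G w a b d)
    (ha : InExactlyTwo p s(w, a)) (hb : InExactlyTwo p s(w, b)) : InExactlyTwo p s(w, d) := by
  have hend : ∀ i, ¬ IsEnd (p i) w := fun i => h.not_isEnd hp hN i hw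
  -- Each path through `w` uses two of the three edges. Separation gives one of each type: `x` uses
  -- `a` and `d`, `y` uses `a` and `b`, `z` uses `b` and `d`. Since `a` and `b` are in two paths
  -- each, there is no further path at `w`.
  obtain ⟨x, hxa, hxb⟩ := hp _ hc.mem_edgeSet _ hc.rotate.mem_edgeSet hc.edge_ne
  obtain ⟨y, hya, hyd⟩ := hp _ hc.swap.mem_edgeSet _ hc.swap.rotate.mem_edgeSet hc.swap.edge_ne
  obtain ⟨z, hzb, hza⟩ := hp _ hc.rotate.mem_edgeSet _ hc.mem_edgeSet hc.edge_ne.symm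
  have hxd := hc.other hxa (hend x) hxb
  have hyb := hc.swap.other hya (hend y) hyd
  have hzd := hc.rotate.swap.other hzb (hend z) hza
  obtain ⟨i, j, hij, hka⟩ := ha
  obtain ⟨k, l, hkl, hkb⟩ := hb
  have hxy : x ≠ y := by rintro rfl; exact hxb hyb
  have hyz : y ≠ z := by rintro rfl; exact hza hya
  refine ⟨x, z, by rintro rfl; exact hza hxa, fun t => ⟨fun ht => ?_, ?_⟩⟩
  · have hty : t ≠ y := by rintro rfl; exact hyd ht
    by_cases hta : s(w, a) ∈ (p t).edges
    · rw [hka] at hta hxa hya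
      grind
    · have htb := hc.rotate.rotate.other ht (hend t) hta
      rw [hkb] at htb hyb hzb
      grind
  · rintro (rfl | rfl) <;> assumption

end IsSubcubic

/-! ### Bounding the colours from below, and attaching two leaves to a leaf. -/

/-- If a path contains `r` edges each of which is in exactly two paths of a rainbow separating
family, at least `r` colours are used. -/
theorem RainbowSeparates.le_colors {ι : Type*} {p : ι → GraphPath G} {k r : ℕ} {c : ι → Fin k}
    (hp : RainbowSeparates G p c) {i : ι} {e : Fin r → Sym2 V} (he : Function.Injective e)
    (hi : ∀ s, e s ∈ (p i).edges) (htwo : ∀ s, InExactlyTwo p (e s)) : r ≤ k := by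
  have : ∀ s, ∃ o, ∀ l, e s ∈ (p l).edges → l = i ∨ l = o := by
    intro s
    obtain ⟨a, b, -, hab⟩ := htwo s
    rcases (hab i).1 (hi s) with rfl | rfl
    · exact ⟨b, fun l hl => (hab l).1 hl⟩
    · exact ⟨a, fun l hl => ((hab l).1 hl).symm⟩
  choose o ho using this
  -- Path `i` contains both `e s` and `e t`, so it separates them in neither direction; only `o s`
  -- and `o t` remain, and they must differ in colour.
  have hinj : Function.Injective (c ∘ o) := by
    intro s t hst
    by_contra hne
    obtain ⟨a, b, hab, ⟨ha, ha'⟩, hb, hb'⟩ := hp _ ((p i).edges_subset (hi s)) _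
      ((p i).edges_subset (hi t)) (fun h => hne (he h))
    rcases ho s a ha with rfl | rfl
    · exact ha' (hi t)
    rcases ho t b hb with rfl | rfl
    · exact hb' (hi s)
    exact hab hst
  simpa using Fintype.card_le_of_injective _ hinj

/-- If two new leaves are attached to a leaf whose edge is in exactly two paths, of distinct
colours, a rainbow separating family extends by one path and one colour. -/
theorem RainbowSeparates.exists_extend {V' : Type*} {G' : SimpleGraph V'} (f : G →g G')
    (hf : Function.Injective f) {l w : V} (hl : IsLeafAt G l w) {a b : V'} (hab : a ≠ b)
    (ha : a ∉ Set.range f) (hb : b ∉ Set.range f) (hal : G'.Adj a (f l)) (hbl : G'.Adj b (f l))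
    (hE : ∀ e ∈ G'.edgeSet, (∃ e' ∈ G.edgeSet, e'.map f = e) ∨ e = s(a, f l) ∨ e = s(b, f l))
    {ι : Type*} {k : ℕ} {p : ι → GraphPath G} {c : ι → Fin k} (hp : RainbowSeparates G p c)
    {i j : ι} (hne : c i ≠ c j) (hij : ∀ t, s(l, w) ∈ (p t).edges ↔ t = i ∨ t = j) :
    ∃ (p' : Option ι → GraphPath G') (c' : Option ι → Fin (k + 1)), RainbowSeparates G' p' c' := by
  have hijne : i ≠ j := fun h => hne (h ▸ rfl)
  -- Path `i` is prolonged to `a` and path `j` to `b`; the others are copied. The path `R` from `a`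
  -- through `f l` to `b`, in the new colour, separates the new edges from the old ones.
  have hex : ∀ t, ∃ P' : GraphPath G', ∀ e, e ∈ P'.edges ↔ (∃ e' ∈ (p t).edges, e'.map f = e) ∨
      (t = i ∧ e = s(a, f l)) ∨ (t = j ∧ e = s(b, f l)) := by
    intro t
    by_cases hti : t = i
    · subst hti
      obtain ⟨P', hP'⟩ := (p t).exists_extend f hf hl ((hij t).2 (Or.inl rfl)) ha hal
      exact ⟨P', fun e => by rw [hP']; simp [hijne]⟩
    by_cases htj : t = j
    · subst htj
      obtain ⟨P', hP'⟩ := (p t).exists_extend f hf hl ((hij t).2 (Or.inr rfl)) hb hbl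
      exact ⟨P', fun e => by rw [hP']; simp [hti]⟩
    · obtain ⟨P', hP'⟩ := (p t).exists_map f hf
      exact ⟨P', fun e => by rw [hP']; simp [hti, htj]⟩
  choose p' hp' using hex
  obtain ⟨R, hR⟩ := GraphPath.exists_length_two hal hbl.symm hab
  have hRa : s(a, f l) ∈ R.edges := by simp [hR]
  have hRb : s(b, f l) ∈ R.edges := by rw [hR]; exact Or.inr Sym2.eq_swap
  have hnew : ∀ (e : Sym2 V) {x : V'}, x ∉ Set.range f → e.map f ≠ s(x, f l) := by
    intro e x hx he
    have hmem : x ∈ e.map f := by rw [he]; simp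
    obtain ⟨y, -, hy⟩ := Sym2.mem_map.1 hmem
    exact hx ⟨y, hy⟩
  have hRold : ∀ e : Sym2 V, e.map f ∉ R.edges := by
    intro e he
    rw [hR] at he
    rcases he with he | he
    · exact hnew e ha he
    · exact hnew e hb (he.trans Sym2.eq_swap)
  have hold : ∀ (e : Sym2 V) t, e.map f ∈ (p' t).edges ↔ e ∈ (p t).edges := by
    intro e t
    rw [hp']
    constructor
    · rintro (⟨e', he', h⟩ | ⟨-, h⟩ | ⟨-, h⟩)
      · exact Sym2.map.injective hf h ▸ he'
      · exact absurd h (hnew e ha)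
      · exact absurd h (hnew e hb)
    · exact fun h => Or.inl ⟨e, h, rfl⟩
  have habe : s(a, f l) ≠ s(b, f l) := fun h => hab (Sym2.congr_left.1 h)
  have hA : ∀ t, s(a, f l) ∈ (p' t).edges ↔ t = i := by
    intro t
    rw [hp']
    constructor
    · rintro (⟨e', -, h⟩ | ⟨h, -⟩ | ⟨-, h⟩)
      · exact absurd h (hnew e' ha)
      · exact h
      · exact absurd h habe
    · exact fun h => Or.inr (Or.inl ⟨h, rfl⟩)
  have hB : ∀ t, s(b, f l) ∈ (p' t).edges ↔ t = j := by
    intro t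
    rw [hp']
    constructor
    · rintro (⟨e', -, h⟩ | ⟨-, h⟩ | ⟨h, -⟩)
      · exact absurd h (hnew e' hb)
      · exact absurd h habe.symm
      · exact h
    · exact fun h => Or.inr (Or.inr ⟨h, rfl⟩)
  -- The leaf edge lies in both `i` and `j`; any other edge lies in a path that avoids the leaf
  -- edge, hence in one different from both.
  have havoid : ∀ g ∈ G.edgeSet, ∀ s, s = i ∨ s = j → ∃ t, t ≠ s ∧ g ∈ (p t).edges := by
    intro g hg s hs
    by_cases hgl : g = s(l, w)
    · subst hgl
      rcases hs with rfl | rfl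
      · exact ⟨j, hijne.symm, (hij j).2 (Or.inr rfl)⟩
      · exact ⟨i, hijne, (hij i).2 (Or.inl rfl)⟩
    · obtain ⟨t, ht, ht'⟩ := hp.separates g hg _ ((hl w).2 rfl : s(l, w) ∈ G.edgeSet) hgl
      exact ⟨t, fun h => ht' ((hij t).2 (h ▸ hs)), ht⟩
  let P : Option ι → GraphPath G' := fun t => t.elim R p'
  let C : Option ι → Fin (k + 1) := fun t => t.elim (Fin.last k) (fun t => (c t).castSucc)
  have hlast : ∀ t, C (some t) ≠ C none := fun t => Fin.castSucc_ne_last (c t)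
  have hsome : ∀ s t, c s ≠ c t → C (some s) ≠ C (some t) := fun s t h h' =>
    h (Fin.castSucc_injective k h')
  refine ⟨P, C, ?_⟩
  have sym : ∀ e g : Sym2 V', (∃ i j, C i ≠ C j ∧
      (e ∈ (P i).edges ∧ g ∉ (P i).edges) ∧ (g ∈ (P j).edges ∧ e ∉ (P j).edges)) →
      ∃ i j, C i ≠ C j ∧
      (g ∈ (P i).edges ∧ e ∉ (P i).edges) ∧ (e ∈ (P j).edges ∧ g ∉ (P j).edges) :=
    fun e g ⟨x, y, h, h1, h2⟩ => ⟨y, x, h.symm, h2, h1⟩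
  have oldA : ∀ g ∈ G.edgeSet, ∃ i j, C i ≠ C j ∧
      (g.map f ∈ (P i).edges ∧ s(a, f l) ∉ (P i).edges) ∧
      (s(a, f l) ∈ (P j).edges ∧ g.map f ∉ (P j).edges) := by
    intro g hg
    obtain ⟨t, hti, ht⟩ := havoid g hg i (Or.inl rfl)
    exact ⟨some t, none, hlast t, ⟨(hold g t).2 ht, fun h => hti ((hA t).1 h)⟩, hRa, hRold g⟩
  have oldB : ∀ g ∈ G.edgeSet, ∃ i j, C i ≠ C j ∧
      (g.map f ∈ (P i).edges ∧ s(b, f l) ∉ (P i).edges) ∧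
      (s(b, f l) ∈ (P j).edges ∧ g.map f ∉ (P j).edges) := by
    intro g hg
    obtain ⟨t, htj, ht⟩ := havoid g hg j (Or.inr rfl)
    exact ⟨some t, none, hlast t, ⟨(hold g t).2 ht, fun h => htj ((hB t).1 h)⟩, hRb, hRold g⟩
  have hAB : ∃ i j, C i ≠ C j ∧
      (s(a, f l) ∈ (P i).edges ∧ s(b, f l) ∉ (P i).edges) ∧
      (s(b, f l) ∈ (P j).edges ∧ s(a, f l) ∉ (P j).edges) :=
    ⟨some i, some j, hsome i j hne, ⟨(hA i).2 rfl, fun h => hijne ((hB i).1 h)⟩,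
      (hB j).2 rfl, fun h => hijne ((hA j).1 h).symm⟩
  intro e he g hg heg
  rcases hE e he with ⟨e, he', rfl⟩ | rfl | rfl <;>
    rcases hE g hg with ⟨g, hg', rfl⟩ | rfl | rfl
  · obtain ⟨x, y, hxy, ⟨h1, h2⟩, h3, h4⟩ := hp e he' g hg' (fun h => heg (h ▸ rfl))
    exact ⟨some x, some y, hsome x y hxy, ⟨(hold e x).2 h1, fun h => h2 ((hold g x).1 h)⟩,
      (hold g y).2 h3, fun h => h4 ((hold e y).1 h)⟩
  · exact oldA e he'
  · exact oldB e he'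
  · exact sym _ _ (oldA g hg')
  · exact absurd rfl heg
  · exact hAB
  · exact sym _ _ (oldB g hg')
  · exact sym _ _ hAB
  · exact absurd rfl heg

/-! ### Trees given by a parent function. -/

/-- The graph on `{0, …, n - 1}` in which every `v ≠ 0` is joined to `q v`. -/
def parentGraph (q : ℕ → ℕ) (n : ℕ) : SimpleGraph (Fin n) :=
  SimpleGraph.fromRel fun x y => y.val ≠ 0 ∧ q y = x

section parentGraph

variable {q : ℕ → ℕ} {n : ℕ}

theorem parentGraph_adj (hq : ∀ v, v ≠ 0 → q v < v) {x y : Fin n} :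
    (parentGraph q n).Adj x y ↔ (y.val ≠ 0 ∧ q y = x) ∨ (x.val ≠ 0 ∧ q x = y) := by
  rw [parentGraph, SimpleGraph.fromRel_adj]
  refine ⟨fun h => h.2, fun h => ⟨?_, h⟩⟩
  rintro rfl
  rcases h with h | h <;> exact (hq x h.1).ne h.2

/-- The edge from `v` to its parent. -/
def parentEdge (hq : ∀ v, v ≠ 0 → q v < v) (v : Fin n) (hv : v.val ≠ 0) : Sym2 (Fin n) :=
  s(v, ⟨q v, (hq v hv).trans v.2⟩)

theorem mem_edgeSet_parentGraph (hq : ∀ v, v ≠ 0 → q v < v) {e : Sym2 (Fin n)} :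
    e ∈ (parentGraph q n).edgeSet ↔ ∃ v hv, e = parentEdge hq v hv := by
  induction e with
  | _ x y =>
    rw [SimpleGraph.mem_edgeSet, parentGraph_adj hq]
    constructor
    · rintro (⟨h, h'⟩ | ⟨h, h'⟩)
      · refine ⟨y, h, ?_⟩
        rw [parentEdge, Sym2.eq_swap]
        congr 2
        exact Fin.ext h'.symm
      · refine ⟨x, h, ?_⟩
        rw [parentEdge]
        congr 2
        exact Fin.ext h'.symm
    · rintro ⟨v, hv, h⟩
      rw [parentEdge, Sym2.eq_iff] at h
      rcases h with ⟨rfl, rfl⟩ | ⟨rfl, rfl⟩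
      · exact Or.inr ⟨hv, rfl⟩
      · exact Or.inl ⟨hv, rfl⟩

theorem parentEdge_eq_iff (hq : ∀ v, v ≠ 0 → q v < v) {v : Fin n} (hv : v.val ≠ 0) {x y : Fin n} :
    parentEdge hq v hv = s(x, y) ↔
      (v.val = x ∧ q v = y) ∨ (v.val = y ∧ q v = x) := by
  simp only [parentEdge, Sym2.eq_iff, Fin.ext_iff]

theorem parentEdge_inj (hq : ∀ v, v ≠ 0 → q v < v) {v w : Fin n} {hv : v.val ≠ 0}
    {hw : w.val ≠ 0} (h : parentEdge hq v hv = parentEdge hq w hw) : v = w := by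
  rw [parentEdge, parentEdge, Sym2.eq_iff] at h
  rcases h with h | h
  · exact h.1
  · have h1 := congrArg Fin.val h.1
    have h2 := congrArg Fin.val h.2
    have := hq v hv
    have := hq w hw
    simp only at h1 h2
    omega

/-- Iterating `q` leads every vertex to `0`, so the graph is connected; its edges are the parent
edges of the nonzero vertices, at most `n - 1` in number. -/
theorem parentGraph_isTree (hq : ∀ v, v ≠ 0 → q v < v) (hn : 0 < n) :
    (parentGraph q n).IsTree := by
  have hconn : (parentGraph q n).Connected := by
    have hreach : ∀ m (hm : m < n), (parentGraph q n).Reachable ⟨m, hm⟩ ⟨0, hn⟩ := by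
      intro m
      induction m using Nat.strong_induction_on with
      | _ m ih =>
        intro hm
        by_cases h0 : m = 0
        · subst h0; rfl
        · have hlt := hq m h0
          refine SimpleGraph.Reachable.trans (SimpleGraph.Adj.reachable ?_) (ih (q m) hlt (by omega))
          exact (parentGraph_adj hq).2 (Or.inr ⟨h0, rfl⟩)
    have : Nonempty (Fin n) := ⟨⟨0, hn⟩⟩
    exact ⟨fun x y => (hreach x x.2).trans (hreach y y.2).symm⟩
  rw [SimpleGraph.isTree_iff_connected_and_card]
  refine ⟨hconn, le_antisymm ?_ hconn.card_vert_le_card_edgeSet_add_one⟩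
  have hsurj : Function.Surjective (fun v : {v : Fin n // v ≠ ⟨0, hn⟩} =>
      (⟨parentEdge hq v.1 (fun h => v.2 (Fin.ext h)), (mem_edgeSet_parentGraph hq).2 ⟨_, _, rfl⟩⟩ :
        (parentGraph q n).edgeSet)) := by
    rintro ⟨e, he⟩
    obtain ⟨v, hv, rfl⟩ := (mem_edgeSet_parentGraph hq).1 he
    exact ⟨⟨v, fun h => hv (congrArg Fin.val h)⟩, rfl⟩
  have h1 : Nat.card (parentGraph q n).edgeSet ≤ _ := Nat.card_le_card_of_surjective _ hsurj
  rw [Nat.card_eq_fintype_card (α := {v : Fin n // v ≠ ⟨0, hn⟩}), Fintype.card_subtype_compl,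
    Fintype.card_subtype_eq, Fintype.card_fin] at h1
  rw [Nat.card_eq_fintype_card (α := Fin n), Fintype.card_fin]
  omega

end parentGraph

/-! ### The trees `binTree L i` and their vertex degrees. -/

/-- The parent of `v` in the tree made of two leaves `0`, `2` at `1`, a path `1, 3, 4, …, L`, and
an infinite binary tree below `L`. -/
def parent (L v : ℕ) : ℕ :=
  if v ≤ L then (if v = 3 then 1 else v - 1) else L + (v - L - 1) / 2

theorem parent_lt {L : ℕ} (v : ℕ) (hv : v ≠ 0) : parent L v < v := by
  unfold parent
  split_ifs <;> omega

/-- The tree with parent function `parent L` in which `L, …, L + i - 1` have two children. -/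
def binTree (L i : ℕ) : SimpleGraph (Fin (L + 1 + 2 * i)) :=
  parentGraph (parent L) (L + 1 + 2 * i)

theorem binTree_adj {L i : ℕ} {x y : Fin (L + 1 + 2 * i)} :
    (binTree L i).Adj x y ↔ (y.val ≠ 0 ∧ parent L y = x) ∨ (x.val ≠ 0 ∧ parent L x = y) :=
  parentGraph_adj parent_lt

/-- The vertices of degree at most two of `binTree L i`. -/
def lowSet (L i : ℕ) : Finset (Fin (L + 1 + 2 * i)) :=
  Finset.univ.filter fun v => v.val ≠ 1 ∧ ¬ (L ≤ v.val ∧ v.val < L + i)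

theorem card_lowSet {L i : ℕ} (hL : 10 ≤ L) : (lowSet L i).card = L + i := by
  have h := Finset.card_filter_add_card_filter_not (s := (Finset.univ : Finset (Fin (L + 1 + 2 * i))))
    (fun v => v.val ≠ 1 ∧ ¬ (L ≤ v.val ∧ v.val < L + i))
  have h2 : (Finset.univ.filter fun v : Fin (L + 1 + 2 * i) =>
      ¬ (v.val ≠ 1 ∧ ¬ (L ≤ v.val ∧ v.val < L + i))).map Fin.valEmbedding
      = insert 1 (Finset.Ico L (L + i)) := by
    ext v
    simp only [Finset.mem_map, Finset.mem_filter, Finset.mem_univ, true_and, Finset.mem_insert,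
      Finset.mem_Ico, Fin.valEmbedding_apply]
    constructor
    · rintro ⟨x, hx, rfl⟩
      omega
    · intro hv
      exact ⟨⟨v, by omega⟩, by simp only; omega, rfl⟩
  have h3 := congrArg Finset.card h2
  rw [Finset.card_map, Finset.card_insert_of_notMem (by simp; omega), Nat.card_Ico] at h3
  rw [h3, Finset.card_univ, Fintype.card_fin] at h
  unfold lowSet
  omega

theorem isCubicAt_one {L i : ℕ} (hL : 10 ≤ L) :
    IsCubicAt (binTree L i) ⟨1, by omega⟩ ⟨0, by omega⟩ ⟨2, by omega⟩ ⟨3, by omega⟩ := by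
  refine ⟨by simp, by simp, by simp, fun t => ?_⟩
  rw [binTree_adj]
  simp only [Fin.ext_iff, parent]
  split_ifs <;> omega

theorem isCubicAt_branch {L i j : ℕ} (hL : 10 ≤ L) (hj : j < i) :
    IsCubicAt (binTree L i) ⟨L + j, by omega⟩ ⟨L + 2 * j + 1, by omega⟩ ⟨L + 2 * j + 2, by omega⟩
      ⟨parent L (L + j), by have := parent_lt (L := L) (L + j) (by omega); omega⟩ := by
  refine ⟨?_, ?_, ?_, fun t => ?_⟩
  · simp
  · simp only [ne_eq, Fin.ext_iff]
    have := parent_lt (L := L) (L + j) (by omega)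
    omega
  · simp only [ne_eq, Fin.ext_iff]
    have := parent_lt (L := L) (L + j) (by omega)
    omega
  · rw [binTree_adj]
    simp only [Fin.ext_iff, parent]
    split_ifs <;> omega

theorem isLeafAt_binTree {L i : ℕ} (hL : 10 ≤ L) {v : Fin (L + 1 + 2 * i)} (hv : L + i ≤ v.val) :
    IsLeafAt (binTree L i) v
      ⟨parent L v, by have := parent_lt (L := L) v (by omega); omega⟩ := by
  intro t
  rw [binTree_adj]
  simp only [Fin.ext_iff, parent]
  split_ifs <;> omega

theorem isSubcubic_binTree {L i : ℕ} (hL : 10 ≤ L) (hi : 1 ≤ i) :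
    IsSubcubic (binTree L i) (lowSet L i) := by
  have hmem : ∀ v : Fin (L + 1 + 2 * i), v ∉ lowSet L i ↔
      v.val = 1 ∨ (L ≤ v.val ∧ v.val < L + i) := by
    intro v
    simp only [lowSet, Finset.mem_filter, Finset.mem_univ, true_and]
    omega
  refine ⟨fun v hv => ?_, fun v hv => ?_, fun v hv => ?_⟩
  · rcases (hmem v).1 hv with h | ⟨h1, h2⟩
    · have : v = ⟨1, by omega⟩ := Fin.ext h
      exact this ▸ ⟨_, _, _, isCubicAt_one hL⟩
    · obtain ⟨j, hj⟩ := Nat.exists_eq_add_of_le h1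
      have : v = ⟨L + j, by omega⟩ := Fin.ext hj
      exact this ▸ ⟨_, _, _, isCubicAt_branch hL (by omega)⟩
  · have hv' := not_congr (hmem v)
    rw [not_not] at hv'
    have hv' := hv'.1 hv
    by_cases hlarge : L + i ≤ v.val
    · left
      refine ⟨_, ?_, isLeafAt_binTree hL hlarge⟩
      rw [hmem]
      have := v.2
      simp only [parent]
      split_ifs <;> omega
    by_cases hsmall : v.val ≤ 2
    · left
      refine ⟨⟨1, by omega⟩, (hmem _).2 (Or.inl rfl), fun t => ?_⟩
      rw [binTree_adj]
      simp only [Fin.ext_iff, parent]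
      split_ifs <;> omega
    · right
      refine ⟨⟨parent L v, by have := parent_lt (L := L) v (by omega); omega⟩,
        ⟨v.val + 1, by omega⟩, ?_, fun t => ?_⟩
      · simp only [ne_eq, Fin.ext_iff]
        have := parent_lt (L := L) v (by omega)
        omega
      · rw [binTree_adj]
        simp only [Fin.ext_iff, parent]
        split_ifs <;> omega
  · rcases (hmem v).1 hv with h | ⟨h1, h2⟩
    · refine ⟨⟨3, by omega⟩, ?_, ⟨4, by omega⟩, ?_, ?_⟩
      · exact binTree_adj.2 (Or.inl ⟨by simp, by simp only [parent]; split_ifs <;> omega⟩)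
      · exact binTree_adj.2 (Or.inl ⟨by simp, by simp only [parent]; split_ifs <;> omega⟩)
      · simp only [ne_eq, Fin.ext_iff]; omega
    · have hlt := parent_lt (L := L) v (by omega)
      -- This keeps the parent of `v` away from the root `0`, so that the parent has a parent of its
      -- own.
      have hge : 4 ≤ parent L v := by simp only [parent]; split_ifs <;> omega
      have hlt' := parent_lt (L := L) (parent L v) (by omega)
      refine ⟨⟨parent L v, by omega⟩, ?_, ⟨parent L (parent L v), by omega⟩, ?_, ?_⟩
      · rw [binTree_adj]; right; exact ⟨by omega, rfl⟩
      · rw [binTree_adj]; right; exact ⟨by simp only; omega, rfl⟩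
      · simp only [ne_eq, Fin.ext_iff]; omega

/-! ### The base tree `binTree L 1`: `L + 1` paths in three colours. -/

/-- The two paths through the edge above `v` in the rainbow separating family of
`binTree L 1`. -/
def pathIndex (L v j : ℕ) : Prop :=
  (v = 1 ∧ (j = 0 ∨ j = 1)) ∨ (v = 2 ∧ (j = 0 ∨ j = 2)) ∨
  (3 ≤ v ∧ v ≤ L + 1 ∧ (j = v - 2 ∨ j = v - 1)) ∨ (v = L + 2 ∧ (j = L - 2 ∨ j = L))

/-- The colours of these paths. -/
def pathColor (L j : ℕ) : ℕ :=
  (if j ≤ 2 then j else if j ≤ L - 3 then j - 1 else j - 2) % 3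

/-- Regard the path indices as vertices of an auxiliary graph whose edges are the tree edges, each
joining its two paths. It consists of triangles `0, 1, 2` and `L - 2, L - 1, L` joined by the path
`2, 3, …, L - 2`. Two edges sharing a vertex need different colours at their other ends; two
disjoint edges fail only if all four ends have one colour. The shifts in `pathColor` settle the
first condition and leave just two monochromatic edges, `{2, 3}` of colour 2 and `{L - 3, L - 2}` of
colour `(L - 4) % 3`, which is 0 because `L` is 1 modulo 3. -/
theorem exists_pathColor_ne {L v w : ℕ} (hL : 10 ≤ L) (h3 : L % 3 = 1) (hv : 1 ≤ v) (hvw : v < w)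
    (hw : w ≤ L + 2) : ∃ a b, a ≤ L ∧ b ≤ L ∧ pathColor L a ≠ pathColor L b ∧
      (pathIndex L v a ∧ ¬ pathIndex L w a) ∧ (pathIndex L w b ∧ ¬ pathIndex L v b) := by
  have hlo : ∀ u, 1 ≤ u → u ≤ L + 2 → ∃ a b, a < b ∧ b ≤ L ∧
      (∀ j, pathIndex L u j ↔ j = a ∨ j = b) ∧
      ((u = 1 ∧ a = 0 ∧ b = 1) ∨ (u = 2 ∧ a = 0 ∧ b = 2) ∨
        (3 ≤ u ∧ u ≤ L + 1 ∧ a = u - 2 ∧ b = u - 1) ∨ (u = L + 2 ∧ a = L - 2 ∧ b = L)) := by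
    intro u h1 h2
    unfold pathIndex
    rcases (by omega : u = 1 ∨ u = 2 ∨ (3 ≤ u ∧ u ≤ L + 1) ∨ u = L + 2) with h | h | h | h
    · exact ⟨0, 1, by omega, by omega, by omega, by omega⟩
    · exact ⟨0, 2, by omega, by omega, by omega, by omega⟩
    · exact ⟨u - 2, u - 1, by omega, by omega, by omega, by omega⟩
    · exact ⟨L - 2, L, by omega, by omega, by omega, by omega⟩
  obtain ⟨a, b, hab, hb, hI, h⟩ := hlo v hv (by omega)
  obtain ⟨a', b', hab', hb', hI', h'⟩ := hlo w (by omega) hw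
  simp only [hI, hI']
  by_contra hcon
  push Not at hcon
  have c1 := hcon a a' (by omega) (by omega)
  have c2 := hcon a b' (by omega) (by omega)
  have c3 := hcon b a' (by omega) (by omega)
  have c4 := hcon b b' (by omega) (by omega)
  unfold pathColor at c1 c2 c3 c4
  clear hcon hI hI' hlo
  rcases h with h | h | h | h <;> rcases h' with h' | h' | h' | h' <;>
    obtain ⟨hu, h⟩ := h <;> obtain ⟨hu', h'⟩ := h' <;> grind

/-- `c` is the child in the edge between `x` and `y`. -/
def IsChild (L c x y : ℕ) : Prop :=
  c ≠ 0 ∧ ((c = x ∧ parent L c = y) ∨ (c = y ∧ parent L c = x))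

theorem IsChild.adj {L i c x y : ℕ} (h : IsChild L c x y) (hx : x < L + 1 + 2 * i)
    (hy : y < L + 1 + 2 * i) : (binTree L i).Adj ⟨x, hx⟩ ⟨y, hy⟩ := by
  rw [binTree_adj]
  rcases h with ⟨h0, ⟨rfl, h⟩ | ⟨rfl, h⟩⟩
  · exact Or.inr ⟨h0, h⟩
  · exact Or.inl ⟨h0, h⟩

theorem IsChild.parentEdge_eq_iff {L i c x y : ℕ} (h : IsChild L c x y) (hx : x < L + 1 + 2 * i)
    (hy : y < L + 1 + 2 * i) {v : Fin (L + 1 + 2 * i)} (hv : v.val ≠ 0) :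
    parentEdge (parent_lt (L := L)) v hv = s(⟨x, hx⟩, ⟨y, hy⟩) ↔ v.val = c := by
  rw [RainbowSep.parentEdge_eq_iff]
  have h1 := parent_lt (L := L) v hv
  rcases h with ⟨h0, ⟨rfl, h⟩ | ⟨rfl, h⟩⟩
  · have h2 := parent_lt (L := L) c h0
    refine ⟨?_, fun hc => Or.inl ⟨hc, hc ▸ h⟩⟩
    simp only
    omega
  · have h2 := parent_lt (L := L) c h0
    refine ⟨?_, fun hc => Or.inr ⟨hc, hc ▸ h⟩⟩
    simp only
    omega

theorem exists_path_length_two {L j x y z c d : ℕ} (hx : x < L + 3) (hy : y < L + 3)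
    (hz : z < L + 3) (hxy : IsChild L c x y) (hyz : IsChild L d y z) (hxz : x ≠ z)
    (h : ∀ v, pathIndex L v j ↔ v = c ∨ v = d) :
    ∃ P : GraphPath (binTree L 1), ∀ (v : Fin (L + 1 + 2 * 1)) (hv : v.val ≠ 0),
      parentEdge (parent_lt (L := L)) v hv ∈ P.edges ↔ pathIndex L v j := by
  obtain ⟨P, hP⟩ := GraphPath.exists_length_two (hxy.adj (i := 1) hx hy) (hyz.adj hy hz)
    (by simpa using hxz)
  refine ⟨P, fun v hv => ?_⟩
  rw [hP, hxy.parentEdge_eq_iff hx hy, hyz.parentEdge_eq_iff hy hz, h]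

theorem exists_path_length_three {L j x y z t c d e : ℕ} (hx : x < L + 3) (hy : y < L + 3)
    (hz : z < L + 3) (ht : t < L + 3) (hxy : IsChild L c x y) (hyz : IsChild L d y z)
    (hzt : IsChild L e z t) (hxz : x ≠ z) (hxt : x ≠ t) (hyt : y ≠ t)
    (h : ∀ v, pathIndex L v j ↔ v = c ∨ v = d ∨ v = e) :
    ∃ P : GraphPath (binTree L 1), ∀ (v : Fin (L + 1 + 2 * 1)) (hv : v.val ≠ 0),
      parentEdge (parent_lt (L := L)) v hv ∈ P.edges ↔ pathIndex L v j := by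
  obtain ⟨P, hP⟩ := GraphPath.exists_length_three (hxy.adj (i := 1) hx hy) (hyz.adj hy hz)
    (hzt.adj hz ht) (by simpa using hxz) (by simpa using hxt) (by simpa using hyt)
  refine ⟨P, fun v hv => ?_⟩
  rw [hP, hxy.parentEdge_eq_iff hx hy, hyz.parentEdge_eq_iff hy hz, hzt.parentEdge_eq_iff hz ht, h]

/-- The edges assigned to an index do form a path of the tree: three edges for `j = 2` and `j = L -
2`, where a triangle of the auxiliary graph meets its connecting path, and two edges otherwise. -/
theorem exists_path {L j : ℕ} (hL : 10 ≤ L) (hj : j ≤ L) :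
    ∃ P : GraphPath (binTree L 1), ∀ (v : Fin (L + 1 + 2 * 1)) (hv : v.val ≠ 0),
      parentEdge (parent_lt (L := L)) v hv ∈ P.edges ↔ pathIndex L v j := by
  have hstep : ∀ x, x ≠ 0 → x ≠ 2 → x ≤ L → IsChild L (x + 1) x (x + 1) := by
    intro x h0 h2 hx
    refine ⟨by omega, Or.inr ⟨rfl, ?_⟩⟩
    unfold parent
    split_ifs <;> omega
  have hfork : IsChild L (L + 2) L (L + 2) := by
    refine ⟨by omega, Or.inr ⟨rfl, ?_⟩⟩
    unfold parent
    split_ifs <;> omega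
  have h01 : IsChild L 1 0 1 := ⟨by omega, Or.inr ⟨rfl, by unfold parent; split_ifs <;> omega⟩⟩
  have h12 : IsChild L 2 1 2 := hstep 1 (by omega) (by omega) (by omega)
  have h13 : IsChild L 3 1 3 := ⟨by omega, Or.inr ⟨rfl, by unfold parent; split_ifs <;> omega⟩⟩
  have hsymm : ∀ {c x y}, IsChild L c x y → IsChild L c y x := fun h => ⟨h.1, h.2.symm⟩
  rcases (by omega : j = 0 ∨ j = 1 ∨ j = 2 ∨ (3 ≤ j ∧ (j ≤ L - 3 ∨ j = L - 1)) ∨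
    j = L - 2 ∨ j = L) with rfl | rfl | rfl | h | h | h
  · exact exists_path_length_two (by omega) (by omega) (by omega) h01 h12 (by omega)
      fun v => by unfold pathIndex; omega
  · exact exists_path_length_two (by omega) (by omega) (by omega) h01 h13 (by omega)
      fun v => by unfold pathIndex; omega
  · exact exists_path_length_three (by omega) (by omega) (by omega) (by omega) (hsymm h12) h13
      (hstep 3 (by omega) (by omega) (by omega)) (by omega) (by omega) (by omega)
      fun v => by unfold pathIndex; omega
  · exact exists_path_length_two (by omega) (by omega) (by omega)
      (hstep j (by omega) (by omega) (by omega)) (hstep (j + 1) (by omega) (by omega) (by omega))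
      (by omega) fun v => by unfold pathIndex; omega
  · have h1 := hstep (L - 2) (by omega) (by omega) (by omega)
    have h2 := hstep (L - 1) (by omega) (by omega) (by omega)
    rw [show L - 2 + 1 = L - 1 by omega] at h1
    rw [show L - 1 + 1 = L by omega] at h2
    exact exists_path_length_three (by omega) (by omega) (by omega) (by omega) h1 h2 hfork
      (by omega) (by omega) (by omega) fun v => by unfold pathIndex; omega
  · exact exists_path_length_two (by omega) (by omega) (by omega)
      (hsymm (hstep L (by omega) (by omega) le_rfl)) hfork (by omega)
      fun v => by unfold pathIndex; omega

theorem hasRainbow_binTree_one {L : ℕ} (hL : 10 ≤ L) (h3 : L % 3 = 1) :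
    HasRainbow (binTree L 1) (L + 1) 3 := by
  choose p hp using fun j : Fin (L + 1) => exists_path hL (Nat.lt_succ_iff.1 j.2)
  refine ⟨p, fun j => ⟨pathColor L j, Nat.mod_lt _ (by omega)⟩, fun e he f hf hef => ?_⟩
  obtain ⟨v, hv, rfl⟩ := (mem_edgeSet_parentGraph parent_lt).1 he
  obtain ⟨w, hw, rfl⟩ := (mem_edgeSet_parentGraph parent_lt).1 hf
  have hvw : v.val ≠ w.val := by
    intro h
    have := Fin.ext h
    subst this
    exact hef rfl
  have hv' := v.2
  have hw' := w.2
  simp only [hp]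
  rcases lt_or_gt_of_ne hvw with hlt | hlt
  · obtain ⟨a, b, ha, hb, hab, h1, h2⟩ :=
      exists_pathColor_ne hL h3 (v := v) (w := w) (by omega) hlt (by omega)
    exact ⟨⟨a, by omega⟩, ⟨b, by omega⟩, fun h => hab (congrArg Fin.val h), h1, h2⟩
  · obtain ⟨a, b, ha, hb, hab, h1, h2⟩ :=
      exists_pathColor_ne hL h3 (v := w) (w := v) (by omega) hlt (by omega)
    exact ⟨⟨b, by omega⟩, ⟨a, by omega⟩, fun h => hab (congrArg Fin.val h).symm, h2, h1⟩

/-! ### Growth of the number of colours, and the choice of the tree. -/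

/-- The leaf `L + i` becomes a branching with two new leaves. The low set grows by one vertex, so
one additional path keeps the family optimal; rigidity supplies the two differently coloured paths
to prolong. -/
theorem HasRainbow.binTree_succ {L i k : ℕ} (hL : 10 ≤ L) (hi : 1 ≤ i)
    (h : HasRainbow (binTree L i) (L + i) k) :
    HasRainbow (binTree L (i + 1)) (L + (i + 1)) (k + 1) := by
  obtain ⟨p, c, hp⟩ := h
  have hsub := isSubcubic_binTree hL hi
  have hcard : Fintype.card (Fin (L + i)) = (lowSet L i).card := by
    rw [card_lowSet hL, Fintype.card_fin]
  have hl := isLeafAt_binTree (i := i) hL (v := ⟨L + i, by omega⟩) le_rfl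
  obtain ⟨s, t, -, hst⟩ := hsub.inExactlyTwo_leaf hp.separates hcard hl
  have hne := hsub.color_ne hp hcard hl hst
  let f : binTree L i →g binTree L (i + 1) :=
    ⟨Fin.castLE (by omega), fun {x y} hxy => by
      rw [binTree_adj] at hxy ⊢
      exact hxy⟩
  have hf : Function.Injective f := Fin.castLE_injective (by omega)
  have hrange : ∀ x : Fin (L + 1 + 2 * (i + 1)), L + 1 + 2 * i ≤ x.val → x ∉ Set.range f := by
    rintro x hx ⟨y, rfl⟩
    have := y.2
    have hy : (f y).val = y.val := rfl
    omega
  have hpar : ∀ x, x = L + 2 * i + 1 ∨ x = L + 2 * i + 2 → parent L x = L + i := by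
    intro x hx
    unfold parent
    split_ifs <;> omega
  have ha := hpar _ (Or.inl rfl)
  have hb := hpar _ (Or.inr rfl)
  have hE : ∀ e ∈ (binTree L (i + 1)).edgeSet, (∃ e' ∈ (binTree L i).edgeSet, e'.map f = e) ∨
      e = s(⟨L + 2 * i + 1, by omega⟩, f ⟨L + i, by omega⟩) ∨
      e = s(⟨L + 2 * i + 2, by omega⟩, f ⟨L + i, by omega⟩) := by
    intro e he
    obtain ⟨v, hv, rfl⟩ := (mem_edgeSet_parentGraph parent_lt).1 he
    by_cases hvn : v.val < L + 1 + 2 * i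
    · left
      exact ⟨parentEdge (parent_lt (L := L)) ⟨v, hvn⟩ hv,
        (mem_edgeSet_parentGraph parent_lt).2 ⟨_, _, rfl⟩, rfl⟩
    · right
      have hv2 := v.2
      have hfl : (f ⟨L + i, by omega⟩).val = L + i := rfl
      have hvp := hpar v (by omega)
      rw [parentEdge_eq_iff, parentEdge_eq_iff, hfl]
      simp only
      omega
  obtain ⟨p', c', hp'⟩ := hp.exists_extend f hf hl (by simp)
    (hrange _ (by simp only; omega)) (hrange _ (by simp only; omega))
    (binTree_adj.2 (Or.inr ⟨by simp, ha⟩)) (binTree_adj.2 (Or.inr ⟨by simp, hb⟩)) hE hne hst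
  exact HasRainbow.of_fintype (by rw [Fintype.card_option, Fintype.card_fin, add_assoc]) hp'

theorem inExactlyTwo_parentEdge {L i : ℕ} (hL : 10 ≤ L) (hi : 1 ≤ i)
    {p : Fin (L + i) → GraphPath (binTree L i)} (hp : Separates (binTree L i) p)
    (v : Fin (L + 1 + 2 * i)) (hv : L + 1 ≤ v.val) (hv0 : v.val ≠ 0) :
    InExactlyTwo p (parentEdge (parent_lt (L := L)) v hv0) := by
  have hsub := isSubcubic_binTree hL hi
  have hcard : Fintype.card (Fin (L + i)) = (lowSet L i).card := by
    rw [card_lowSet hL, Fintype.card_fin]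
  -- The induction runs from the largest label `L + 2 * i` downwards, so both children are treated
  -- before their parent.
  induction hm : L + 2 * i - v.val using Nat.strong_induction_on generalizing v with
  | _ m ih =>
    by_cases hleaf : L + i ≤ v.val
    · exact hsub.inExactlyTwo_leaf hp hcard (isLeafAt_binTree hL hleaf)
    · obtain ⟨j, hj, rfl⟩ : ∃ j, ∃ h : L + j < L + 1 + 2 * i, v = ⟨L + j, h⟩ :=
        ⟨v - L, by omega, Fin.ext (by simp only; omega)⟩
      simp only at hv hm hleaf
      have hc := isCubicAt_branch (i := i) (j := j) hL (by omega)
      refine hsub.inExactlyTwo_cubic hp hcard ?_ hc ?_ ?_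
      · simp only [lowSet, Finset.mem_filter, Finset.mem_univ, true_and]
        omega
      · have := ih _ (by simp only; omega) ⟨L + 2 * j + 1, by omega⟩ (by simp only; omega)
          (by simp) rfl
        rwa [(parentEdge_eq_iff _ _).2 (Or.inr ⟨rfl, ?_⟩)] at this
        simp only [parent]
        split_ifs <;> omega
      · have := ih _ (by simp only; omega) ⟨L + 2 * j + 2, by omega⟩ (by simp only; omega)
          (by simp) rfl
        rwa [(parentEdge_eq_iff _ _).2 (Or.inr ⟨rfl, ?_⟩)] at this
        simp only [parent]
        split_ifs <;> omega

/-- The number of colours needed grows with the depth of the binary tree. -/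
theorem HasRainbow.binTree_le {L i k r : ℕ} (hL : 10 ≤ L) (hr : 3 * 2 ^ r ≤ i)
    (h : HasRainbow (binTree L i) (L + i) k) : r + 1 ≤ k := by
  obtain ⟨p, c, hp⟩ := h
  have hpos : 1 ≤ 2 ^ r := Nat.one_le_two_pow
  have hi : 1 ≤ i := by omega
  have hsub := isSubcubic_binTree hL hi
  have hcard : Fintype.card (Fin (L + i)) = (lowSet L i).card := by
    rw [card_lowSet hL, Fintype.card_fin]
  let E : ∀ v : Fin (L + 1 + 2 * i), v.val ≠ 0 → Sym2 _ := parentEdge (parent_lt (L := L))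
  have hE : ∀ v hv, E v hv ∈ (binTree L i).edgeSet := fun v hv =>
    (mem_edgeSet_parentGraph parent_lt).2 ⟨v, hv, rfl⟩
  obtain ⟨t, ht, -⟩ := hp.separates _ (hE ⟨L + 1, by omega⟩ (by simp)) _
    (hE ⟨L + 2, by omega⟩ (by simp)) (fun h => by simpa using parentEdge_inj _ h)
  -- The path `t` is followed downwards: it cannot end at a cubic vertex, so it continues to a
  -- child. For `m = L + j` a child is at most `L + 2 * j + 2`, so the bound on `j + 2` doubles at
  -- each step, starting from 3. The hypothesis `3 * 2 ^ r ≤ i` keeps `m` a branching vertex before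
  -- each descent.
  have chain : ∀ s ≤ r, ∃ (S : Finset (Fin (L + 1 + 2 * i))) (m : Fin (L + 1 + 2 * i)),
      S.card = s + 1 ∧ m ∈ S ∧ (∀ v ∈ S, v ≤ m) ∧ m.val + 2 ≤ L + 3 * 2 ^ s ∧
      ∀ v ∈ S, L + 1 ≤ v.val ∧ ∀ hv, E v hv ∈ (p t).edges := by
    intro s
    induction s with
    | zero =>
      intro _
      exact ⟨{⟨L + 1, by omega⟩}, ⟨L + 1, by omega⟩, by simp, by simp, by simp, by simp,
        by simpa using ht⟩
    | succ s ih =>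
      intro hs
      obtain ⟨S, m, hSc, hmS, hmax, hm, hS⟩ := ih (by omega)
      have hpow : 2 ^ s ≤ 2 ^ r := Nat.pow_le_pow_right (by omega) (by omega)
      obtain ⟨hmL, hmt⟩ := hS m hmS
      have next : ∃ m' : Fin (L + 1 + 2 * i), m < m' ∧ m'.val + 2 ≤ L + 3 * 2 ^ (s + 1) ∧
          ∀ hv, E m' hv ∈ (p t).edges := by
        obtain ⟨j, hj, rfl⟩ : ∃ j, ∃ h : L + j < L + 1 + 2 * i, m = ⟨L + j, h⟩ :=
          ⟨m - L, by omega, Fin.ext (by simp only; omega)⟩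
        simp only at hm hmL
        have hc := isCubicAt_branch (i := i) (j := j) hL (by omega)
        have hend := hsub.not_isEnd hp.separates hcard t (w := ⟨L + j, by omega⟩) (by
          simp only [lowSet, Finset.mem_filter, Finset.mem_univ, true_and]
          omega)
        have hin := hmt (by simp only; omega)
        have hpar : ∀ x, x = L + 2 * j + 1 ∨ x = L + 2 * j + 2 → parent L x = L + j := by
          intro x hx
          unfold parent
          split_ifs <;> omega
        have hE' : ∀ (x : Fin (L + 1 + 2 * i)) hx, x.val = L + 2 * j + 1 ∨ x.val = L + 2 * j + 2 →
            E x hx = s(⟨L + j, by omega⟩, x) := fun x hx hx' =>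
          (parentEdge_eq_iff _ _).2 (Or.inr ⟨rfl, hpar x hx'⟩)
        rw [pow_succ]
        by_cases h1 : s(⟨L + j, by omega⟩, ⟨L + 2 * j + 1, by omega⟩) ∈ (p t).edges
        · refine ⟨⟨L + 2 * j + 1, by omega⟩, ?_, by simp only; omega, fun hv => ?_⟩
          · rw [Fin.lt_def]; simp only; omega
          · rw [hE' _ _ (Or.inl rfl)]; exact h1
        · refine ⟨⟨L + 2 * j + 2, by omega⟩, ?_, by simp only; omega, fun hv => ?_⟩
          · rw [Fin.lt_def]; simp only; omega
          · rw [hE' _ _ (Or.inr rfl)]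
            exact hc.rotate.rotate.other hin hend h1
      obtain ⟨m', hlt, hm', hin⟩ := next
      have hnot : m' ∉ S := fun h => absurd (hmax m' h) (not_le.2 hlt)
      refine ⟨insert m' S, m', by rw [Finset.card_insert_of_notMem hnot, hSc],
        Finset.mem_insert_self _ _, fun v hv => ?_, hm', fun v hv => ?_⟩
      · rcases Finset.mem_insert.1 hv with rfl | hv
        · exact le_rfl
        · exact (hmax v hv).trans hlt.le
      · rcases Finset.mem_insert.1 hv with rfl | hv
        · exact ⟨by have := Fin.lt_def.1 hlt; omega, hin⟩
        · exact hS v hv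
  obtain ⟨S, m, hSc, -, -, -, hS⟩ := chain r le_rfl
  let g : Fin (r + 1) → S := (Fintype.equivFinOfCardEq (by simpa using hSc)).symm
  have hg : Function.Injective g := Equiv.injective _
  have h0 : ∀ s, (g s).1.val ≠ 0 := fun s => by
    have := (hS _ (g s).2).1
    omega
  refine hp.le_colors (i := t) (e := fun s => E (g s).1 (h0 s)) (fun x y hxy => ?_) (fun s => ?_)
    (fun s => ?_)
  · exact hg (Subtype.ext (parentEdge_inj _ hxy))
  · exact (hS _ (g s).2).2 _
  · exact inExactlyTwo_parentEdge hL hi hp.separates _ (hS _ (g s).2).1 _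

/-- A discrete intermediate value argument: at the least `i` where `k` colours are necessary, they
also suffice, because the preceding tree manages with fewer than `k` and one step adds at most one
colour. -/
theorem exists_binTree_min_colors {L k : ℕ} (hL : 10 ≤ L) (h3 : L % 3 = 1) (hk : 3 ≤ k) :
    ∃ i, 1 ≤ i ∧ HasRainbow (binTree L i) (L + i) k ∧
      ∀ j, 2 ≤ j → HasRainbow (binTree L i) (L + i) j → k ≤ j := by
  classical
  have hex : ∃ i, 1 ≤ i ∧ ∀ j, 2 ≤ j → HasRainbow (binTree L i) (L + i) j → k ≤ j := by
    refine ⟨3 * 2 ^ k, ?_, fun j _ hj => ?_⟩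
    · have := Nat.one_le_two_pow (n := k)
      omega
    · have := hj.binTree_le hL le_rfl
      omega
  obtain ⟨hi, hmin⟩ := Nat.find_spec hex
  refine ⟨Nat.find hex, hi, ?_, hmin⟩
  have hprev := fun i => Nat.find_min hex (m := i)
  generalize Nat.find hex = i at hi hmin hprev
  obtain ⟨i, rfl⟩ := Nat.exists_eq_add_of_le' hi
  by_cases h0 : i = 0
  · subst h0
    have hbase := hasRainbow_binTree_one hL h3
    have := hmin 3 (by omega) hbase
    have hk3 : k = 3 := by omega
    exact hk3 ▸ hbase
  · have := hprev i (by omega)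
    push Not at this
    obtain ⟨j, hj2, hj, hjk⟩ := this (by omega)
    have hsucc := hj.binTree_succ hL (by omega)
    have := hmin (j + 1) (by omega) hsucc
    have hkj : k = j + 1 := by omega
    exact hkj ▸ hsucc

theorem exists_large_tree {k : ℕ} (hk : 3 ≤ k) (N : ℕ) :
    ∃ n > N, ∃ T : SimpleGraph (Fin n), T.IsTree ∧ chromaticSepNumber T = (k : ℕ∞) := by
  -- The value `3 * N + 10` is 1 modulo 3, at least 10, and forces more than `N` vertices.
  obtain ⟨i, hi, hA, hmin⟩ :=
    exists_binTree_min_colors (L := 3 * N + 10) (by omega) (by omega) hk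
  refine ⟨3 * N + 10 + 1 + 2 * i, by omega, binTree (3 * N + 10) i,
    parentGraph_isTree parent_lt (by omega), ?_⟩
  refine chromaticSepNumber_eq (fun n p hp => ?_) (by omega) hA hmin
  have := (isSubcubic_binTree (L := 3 * N + 10) (by omega) hi).card_low_le hp
  rwa [card_lowSet (by omega), Fintype.card_fin] at this

end RainbowSep

theorem mainTheorem12 (k : ℕ) (hk : 3 ≤ k) :
    ∃ (n : ℕ → ℕ) (T : ∀ i : ℕ, SimpleGraph (Fin (n i))),
      (∀ i, (T i).IsTree ∧ RainbowSep.chromaticSepNumber (T i) = (k : ℕ∞)) ∧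
      ∀ i j, i ≠ j → IsEmpty (T i ≃g T j) := by
  -- Strictly increasing numbers of vertices make the trees pairwise non-isomorphic.
  obtain ⟨n, hn, h⟩ := Nat.exists_strictMono_subsequence (RainbowSep.exists_large_tree hk)
  choose T hT using h
  refine ⟨n, T, hT, fun i j hij => ⟨fun e => hij (hn.injective ?_)⟩⟩
  simpa using Fintype.card_congr e.toEquiv
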